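/- A kernel is an integrable bounded function $K:\mathbb R\to\mathbb R$, continuous at $0$, with $\int K=1$ and $\int K^2<2K(0)$. Write $K_h(x)=K(x/h)/h$ for $h>0$. If $X_1,\dots,X_n$ is an i.i.d. sample from a probability density $f$ on $\mathbb R$, put $f_{n,K,h}(x)=\frac1n\sum_{i=1}^nK_h(x-X_i)$, $\mathrm{MISE}_f(f_{n,K,h})=E_f\int (f_{n,K,h}(x)-f(x))^2\,dx$ and $\Phi(n,f,K)=\min_{h>0}\mathrm{MISE}_f(f_{n,K,h})$. Let $\varphi_K(t)=\int e^{itx}K(x)\,dx$ and $$S_K=\inf\{t\ge0:\ |\varphi_K(t)-1|\ne0\},\qquad T_K=\inf\{r\ge0:\ |\varphi_K(t)-1|\neq0\ \text{for a.e. } t\ge r\}.$$ **Theorem 2.** Let $K\in L_2$ be a kernel with $S_K=T_K$. Then the minimum defining $\Phi(n,f,K)$ is attained for every density $f\in L_2$ and every $n\ge1$, and the following statements are equivalent: (i) $S_K>0$; (ii) there is a density $f\in L_2$ such that $\Phi(n,f,K)$ is of exact order $n^{-1}$, that is, $\lim_{n\to\infty}n\,\Phi(n,f,K)=\alpha$ for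 some $\alpha\in(0,\infty)$. -/

import Mathlib

open MeasureTheory Filter Topology
open scoped ENNReal

namespace KernelDensity

/-- A kernel: an integrable function with integral one which is bounded, continuous at zero and
satisfies `∫ K² < 2 K(0)`. -/
structure IsKernel (K : ℝ → ℝ) : Prop where
  integrable : Integrable K
  integral_eq_one : ∫ x, K x = 1
  bounded : ∃ C : ℝ, ∀ x, |K x| ≤ C
  continuousAt_zero : ContinuousAt K 0
  integral_sq_lt : ∫ x, K x ^ 2 < 2 * K 0

/-- A probability density on the real line. -/
structure IsDensity (f : ℝ → ℝ) : Prop where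
  integrable : Integrable f
  nonneg : 0 ≤ᵐ[volume] f
  integral_eq_one : ∫ x, f x = 1

/-- The probability law with density `f`. -/
noncomputable def law (f : ℝ → ℝ) : Measure ℝ :=
  volume.withDensity fun x => ENNReal.ofReal (f x)

/-- The rescaled kernel `K_h(x) = K(x / h) / h`. -/
noncomputable def rescale (K : ℝ → ℝ) (h : ℝ) (x : ℝ) : ℝ := K (x / h) / h

/-- The kernel density estimator `f_{n,K,h}(x) = (1/n) ∑ K_h(x - X_i)` built from the sample
`X = (X_1, …, X_n)`. -/
noncomputable def estimator (n : ℕ) (K : ℝ → ℝ) (h : ℝ) (X : Fin n → ℝ) (x : ℝ) : ℝ :=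
  1 / (n : ℝ) * ∑ i, rescale K h (x - X i)

/-- The mean integrated squared error `E_f ∫ (f_{n,K,h}(x) - f(x))² dx`, the expectation being
over `n` independent observations with density `f`. It is a `[0, ∞]`-valued integral, so that no
integrability convention is involved. -/
noncomputable def mise (n : ℕ) (f K : ℝ → ℝ) (h : ℝ) : ℝ≥0∞ :=
  ∫⁻ X : Fin n → ℝ, (∫⁻ x : ℝ, ENNReal.ofReal ((estimator n K h X x - f x) ^ 2))
    ∂(Measure.pi fun _ : Fin n => law f)

/-- The minimal mean integrated squared error `Φ(n, f, K)` over all bandwidths `h > 0`. -/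
noncomputable def minMise (n : ℕ) (f K : ℝ → ℝ) : ℝ≥0∞ :=
  ⨅ h : Set.Ioi (0 : ℝ), mise n f K h

/-- A sequence `a` is of exact order `n⁻¹`: `n a_n` tends to a limit in `(0, ∞)`. -/
def IsExactOrderInv (a : ℕ → ℝ≥0∞) : Prop :=
  ∃ α : ℝ≥0∞, 0 < α ∧ α < ∞ ∧ Tendsto (fun n : ℕ => (n : ℝ≥0∞) * a n) atTop (𝓝 α)

/-- The characteristic function `φ_K(t) = ∫ exp(i t x) K(x) dx`. -/
noncomputable def charFn (K : ℝ → ℝ) (t : ℝ) : ℂ :=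
  ∫ x : ℝ, Complex.exp (Complex.I * (t : ℂ) * (x : ℂ)) * (K x : ℂ)

/-- `S_K = inf {t ≥ 0 : |φ_K(t) - 1| ≠ 0}`. -/
noncomputable def firstExit (K : ℝ → ℝ) : ℝ :=
  sInf {t : ℝ | 0 ≤ t ∧ ‖charFn K t - 1‖ ≠ 0}

/-- `T_K = inf {r ≥ 0 : |φ_K(t) - 1| ≠ 0 for almost every t ≥ r}`. -/
noncomputable def lastExit (K : ℝ → ℝ) : ℝ :=
  sInf {r : ℝ | 0 ≤ r ∧ ∀ᵐ t : ℝ, r ≤ t → ‖charFn K t - 1‖ ≠ 0}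

end KernelDensity

/-! Write `f̂`, `K̂` for Fourier transforms. Independence and Plancherel give, for square-integrable
`f`, MISE = B(h) + V(h)/n, with B(h) = ∫ |f̂(ξ)|² |1 - K̂(hξ)|² dξ and V(h) = ∫ |K̂(hξ)|² (1 -
|f̂(ξ)|²) dξ (`mise_eq_risk`, `spread_eq_integral`). Only the factor 1/n depends on n.

Attainment: the risk is continuous in h > 0, blows up as h → 0 because V does, and tends to ∫ f² as
h → ∞. The condition ∫ K² < 2 K(0) forces a value strictly below ∫ f² at some large h
(`exists_risk_lt`), so the infimum is a minimum over a compact interval.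

Exact order: n Φ(n) is the minimum of n B(h) + V(h), hence nondecreasing in n. If B(h₀) = 0 for some
h₀, it is bounded by V(h₀) and converges to a finite limit, positive by `risk_pos`. If B never
vanishes, small h are too costly through V and all others through n B, so n Φ(n) cannot have a
finite limit.

It remains to decide when B can vanish. If S_K > 0, then K̂ = 1 near zero, and any density whose
transform is supported there has B(1) = 0. If S_K = T_K = 0, then K̂(hξ) ≠ 1 for almost every ξ < 0,
whereas f̂ ≠ 0 near zero, so B(h) > 0 for every h and every f. -/

namespace KernelDensity

open scoped FourierTransform SchwartzMap ComplexConjugate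

/-! ### Fourier transform on `L¹` and Plancherel on `L¹ ∩ L²` -/

/-- The Fourier transform of a real function, with frequency normalised by `2π`. -/
noncomputable def realFourier (u : ℝ → ℝ) : ℝ → ℂ := 𝓕 (fun x => (u x : ℂ))

theorem realFourier_apply (u : ℝ → ℝ) (ξ : ℝ) :
    realFourier u ξ = ∫ x : ℝ, Complex.exp (↑(-2 * Real.pi * x * ξ) * Complex.I) * (u x : ℂ) := by
  rw [realFourier, Real.fourier_real_eq_integral_exp_smul]; rfl

theorem realFourier_zero (u : ℝ → ℝ) : realFourier u 0 = ((∫ x, u x : ℝ) : ℂ) := by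
  rw [realFourier_apply, ← integral_complex_ofReal]; simp

theorem norm_realFourier_le (u : ℝ → ℝ) (ξ : ℝ) : ‖realFourier u ξ‖ ≤ ∫ x, |u x| := by
  rw [realFourier_apply]
  refine (norm_integral_le_integral_norm _).trans_eq ?_
  congr with x
  rw [norm_mul, Complex.norm_exp_ofReal_mul_I, one_mul, Complex.norm_real, Real.norm_eq_abs]

theorem continuous_realFourier {u : ℝ → ℝ} (hu : Integrable u) : Continuous (realFourier u) :=
  VectorFourier.fourierIntegral_continuous Real.continuous_fourierChar
    (innerSL ℝ).continuous₂ hu.ofReal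

theorem tendsto_realFourier_cocompact (u : ℝ → ℝ) :
    Tendsto (realFourier u) (cocompact ℝ) (𝓝 0) :=
  Real.zero_at_infty_fourier _

theorem realFourier_sub {u v : ℝ → ℝ} (hu : Integrable u) (hv : Integrable v) (ξ : ℝ) :
    realFourier (fun x => u x - v x) ξ = realFourier u ξ - realFourier v ξ := by
  simp only [realFourier, Real.fourier_eq]
  rw [← integral_sub]
  · congr with x; simp [smul_sub]
  · exact (Real.fourierIntegral_convergent_iff ξ).2 hu.ofReal
  · exact (Real.fourierIntegral_convergent_iff ξ).2 hv.ofReal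

theorem realFourier_rescale (K : ℝ → ℝ) {h : ℝ} (hh : 0 < h) (ξ : ℝ) :
    realFourier (rescale K h) ξ = realFourier K (h * ξ) := by
  rw [realFourier_apply, realFourier_apply]
  have := Measure.integral_comp_div (fun y : ℝ =>
    Complex.exp (↑(-2 * Real.pi * y * (h * ξ)) * Complex.I) * (K y : ℂ)) h
  rw [abs_of_pos hh] at this
  have h2 : ∫ y : ℝ, Complex.exp (↑(-2 * Real.pi * y * (h * ξ)) * Complex.I) * (K y : ℂ) =
      (h⁻¹ : ℝ) • ∫ x : ℝ, Complex.exp (↑(-2 * Real.pi * (x / h) * (h * ξ)) * Complex.I) *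
        (K (x / h) : ℂ) := by
    rw [this, smul_smul, inv_mul_cancel₀ hh.ne', one_smul]
  rw [h2, ← integral_smul]
  congr with x
  have : x / h * (h * ξ) = x * ξ := by field_simp
  rw [rescale, mul_assoc (-2 * Real.pi) (x / h), this, ← mul_assoc, Complex.real_smul]
  push_cast
  field_simp

theorem charFn_eq_realFourier (K : ℝ → ℝ) (t : ℝ) :
    charFn K t = realFourier K (-t / (2 * Real.pi)) := by
  rw [realFourier_apply, charFn]
  congr with x
  have : -2 * Real.pi * x * (-t / (2 * Real.pi)) = t * x := by field_simp
  rw [this]; push_cast; ring_nf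

theorem realFourier_neg (K : ℝ → ℝ) (ξ : ℝ) : realFourier K (-ξ) = conj (realFourier K ξ) := by
  rw [realFourier_apply, realFourier_apply, ← integral_conj]
  congr with x
  rw [map_mul, ← Complex.exp_conj]
  simp only [map_mul, Complex.conj_ofReal, Complex.conj_I]
  push_cast
  ring_nf

theorem realFourier_convolution {u v : ℝ → ℝ} (hu : Integrable u) (hv : Integrable v) (ξ : ℝ) :
    realFourier (fun x => ∫ y, u y * v (x - y)) ξ = realFourier u ξ * realFourier v ξ := by
  have := Real.fourier_mul_convolution_eq (R := ℂ) hu.ofReal hv.ofReal ξ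
  simp only [RCLike.ofReal_eq_complex_ofReal] at this
  rw [realFourier, realFourier, realFourier, ← this]
  refine congrArg (fun w : ℝ → ℂ => 𝓕 w ξ) (funext fun x => ?_)
  rw [convolution_def, ← integral_complex_ofReal]
  simp

/-- The `L²` Fourier transform of an integrable square-integrable function is given by the Fourier
integral. -/
theorem fourier_toLp_ae_eq {u : ℝ → ℂ} (hu : Integrable u) (hu2 : MemLp u 2 volume) :
    ((𝓕 (hu2.toLp u) : Lp ℂ 2 (volume : Measure ℝ)) : ℝ → ℂ) =ᵐ[volume] 𝓕 u := by
  have hc : Continuous (𝓕 u) := VectorFourier.fourierIntegral_continuous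
    Real.continuous_fourierChar (innerSL ℝ).continuous₂ hu
  refine ae_eq_of_integral_contDiff_smul_eq (μ := volume)
    ((Lp.memLp (𝓕 (hu2.toLp u))).locallyIntegrable (by norm_num)) hc.locallyIntegrable ?_
  intro g hg hgs
  have hgs' : HasCompactSupport (fun x => (g x : ℂ)) := hgs.comp_left (g := fun x : ℝ => (x : ℂ)) rfl
  let s : 𝓢(ℝ, ℂ) := hgs'.toSchwartzMap (Complex.ofRealCLM.contDiff.comp hg)
  have hs : ∀ x, s x = (g x : ℂ) := fun x => rfl
  -- The `L²` transform agrees with the distributional one, so testing against `s` moves the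
  -- transform onto `s`; the multiplication formula then moves it back onto the integrable `u`.
  have h1 := congrArg (fun T => T s) (Lp.fourier_toTemperedDistribution_eq (hu2.toLp u))
  simp only [TemperedDistribution.fourier_apply, Lp.toTemperedDistribution_apply] at h1
  have h2 : ∫ x, (𝓕 s : 𝓢(ℝ, ℂ)) x • (hu2.toLp u : ℝ → ℂ) x = ∫ x, 𝓕 (s : ℝ → ℂ) x • u x := by
    refine integral_congr_ae ?_
    filter_upwards [hu2.coeFn_toLp] with x hx
    rw [hx, SchwartzMap.fourier_coe]
  have h3 : ∫ x, 𝓕 (s : ℝ → ℂ) x • u x = ∫ x, s x • 𝓕 u x := by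
    have := VectorFourier.integral_fourierIntegral_smul_eq_flip (L := innerₗ ℝ) (μ := volume)
      (ν := volume) Real.continuous_fourierChar continuous_inner s.integrable hu
    rwa [flip_innerₗ] at this
  rw [h2, h3] at h1
  simpa only [hs, Complex.coe_smul, smul_eq_mul, Complex.real_smul] using h1.symm

/-- Plancherel's theorem for real functions in `L¹ ∩ L²`. -/
theorem plancherel {u : ℝ → ℝ} (hu : Integrable u) (hu2 : MemLp u 2 volume) :
    Integrable (fun ξ => ‖realFourier u ξ‖ ^ 2) ∧ ∫ ξ, ‖realFourier u ξ‖ ^ 2 = ∫ x, u x ^ 2 := by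
  have hc2 : MemLp (fun x => (u x : ℂ)) 2 volume := hu2.ofReal
  have hae := fourier_toLp_ae_eq (u := fun x => (u x : ℂ)) hu.ofReal hc2
  have hm : MemLp (realFourier u) 2 volume := (memLp_congr_ae hae).1 (Lp.memLp _)
  refine ⟨(memLp_two_iff_integrable_sq_norm hm.1).1 hm, ?_⟩
  have key : ∀ v : Lp (α := ℝ) ℂ 2, ∫ x, ‖(v : ℝ → ℂ) x‖ ^ 2 = ‖v‖ ^ 2 := fun v => by
    have h := @inner_self_eq_norm_sq_to_K ℂ _ _ _ _ v
    rw [L2.inner_def] at h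
    simp only [inner_self_eq_norm_sq_to_K] at h
    have h' : ((∫ x, ‖(v : ℝ → ℂ) x‖ ^ 2 : ℝ) : ℂ) = ((‖v‖ ^ 2 : ℝ) : ℂ) := by
      rw [← integral_complex_ofReal]
      simpa using h
    exact_mod_cast h'
  have h1 := key (𝓕 (hc2.toLp _))
  have h2 := key (hc2.toLp _)
  rw [Lp.norm_fourier_eq, ← h2] at h1
  have h3 : ∫ ξ, ‖realFourier u ξ‖ ^ 2 = _ :=
    integral_congr_ae (hae.symm.mono fun x hx => congrArg (fun z : ℂ => ‖z‖ ^ 2) hx)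
  rw [h3, h1]
  refine integral_congr_ae (hc2.coeFn_toLp.mono fun x hx => ?_)
  simp only [hx, Complex.norm_real, Real.norm_eq_abs, sq_abs]

/-! ### Laws with a density and the mean squared error of a sample mean -/

theorem IsDensity.lintegral_eq_one {f : ℝ → ℝ} (hf : IsDensity f) :
    ∫⁻ x, ENNReal.ofReal (f x) = 1 := by
  rw [← ofReal_integral_eq_lintegral_ofReal hf.integrable hf.nonneg, hf.integral_eq_one,
    ENNReal.ofReal_one]

theorem IsDensity.isProbabilityMeasure {f : ℝ → ℝ} (hf : IsDensity f) :
    IsProbabilityMeasure (law f) :=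
  ⟨by rw [law, withDensity_apply _ MeasurableSet.univ, setLIntegral_univ, hf.lintegral_eq_one]⟩

theorem IsDensity.integral_law {f : ℝ → ℝ} (hf : IsDensity f) (φ : ℝ → ℝ) :
    ∫ y, φ y ∂(law f) = ∫ y, f y * φ y := by
  rw [law, integral_withDensity_eq_integral_toReal_smul₀ hf.integrable.aemeasurable.ennreal_ofReal
    (ae_of_all _ fun _ => ENNReal.ofReal_lt_top)]
  refine integral_congr_ae (hf.nonneg.mono fun x hx => ?_)
  simp only [ENNReal.toReal_ofReal hx, smul_eq_mul]

theorem law_absolutelyContinuous (f : ℝ → ℝ) : law f ≪ volume :=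
  withDensity_absolutelyContinuous _ _

/-- The mean squared error of a sample mean is the squared bias plus the variance over `n`. -/
theorem lintegral_sampleMean_sub_sq {μ : Measure ℝ} [IsProbabilityMeasure μ] {φ : ℝ → ℝ}
    (hφ : MemLp φ 2 μ) {n : ℕ} (hn : 0 < n) (c : ℝ) :
    ∫⁻ X : Fin n → ℝ, ENNReal.ofReal ((1 / (n : ℝ) * ∑ i, φ (X i) - c) ^ 2)
      ∂(Measure.pi fun _ : Fin n => μ) =
    ENNReal.ofReal ((∫ y, φ y ∂μ - c) ^ 2 + 1 / (n : ℝ) * (∫ y, φ y ^ 2 ∂μ - (∫ y, φ y ∂μ) ^ 2)) := by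
  have hn' : (n : ℝ) ≠ 0 := by positivity
  set P := Measure.pi fun _ : Fin n => μ
  have hi : ∀ i : Fin n, MemLp (fun X : Fin n → ℝ => φ (X i)) 2 P := fun i =>
    hφ.comp_measurePreserving (measurePreserving_eval (fun _ : Fin n => μ) i)
  have hS : MemLp (fun X : Fin n → ℝ => ∑ i, φ (X i)) 2 P := memLp_finsetSum _ fun i _ => hi i
  have hZ : MemLp (fun X : Fin n → ℝ => 1 / (n : ℝ) * ∑ i, φ (X i) - c) 2 P :=
    (hS.const_mul _).sub (memLp_const c)
  have hES : ∫ X, (∑ i, φ (X i)) ∂P = n * ∫ y, φ y ∂μ := by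
    rw [integral_finsetSum _ fun i _ => (hi i).integrable (by norm_num)]
    have : ∀ i : Fin n, ∫ X, φ (X i) ∂P = ∫ y, φ y ∂μ := fun i =>
      integral_comp_eval (μ := fun _ : Fin n => μ) hφ.1
    simp [this]
  have hVS : ProbabilityTheory.variance (fun X : Fin n → ℝ => ∑ i, φ (X i)) P =
      n * ProbabilityTheory.variance φ μ := by
    have := ProbabilityTheory.variance_sum_pi (μ := fun _ : Fin n => μ) (X := fun _ => φ)
      (fun _ => hφ)
    have h2 : (∑ i : Fin n, fun X : Fin n → ℝ => φ (X i)) = fun X => ∑ i, φ (X i) := by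
      ext X; simp
    rw [h2] at this
    rw [this]; simp
  have hvar := ProbabilityTheory.variance_eq_sub hφ
  have hEZ : ∫ X, (1 / (n : ℝ) * ∑ i, φ (X i) - c) ∂P = ∫ y, φ y ∂μ - c := by
    rw [integral_sub ((hS.const_mul _).integrable (by norm_num)) (integrable_const c),
      integral_const_mul, hES]
    simp [hn']
  have hVZ : ProbabilityTheory.variance (fun X : Fin n → ℝ => 1 / (n : ℝ) * ∑ i, φ (X i) - c) P =
      1 / (n : ℝ) * ProbabilityTheory.variance φ μ := by
    rw [ProbabilityTheory.variance_sub_const (hS.const_mul _).1,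
      ProbabilityTheory.variance_const_mul, hVS]
    field_simp
  have hZ2 := ProbabilityTheory.variance_eq_sub hZ
  simp only [Pi.pow_apply] at hZ2 hvar
  rw [← ofReal_integral_eq_lintegral_ofReal hZ.integrable_sq (ae_of_all _ fun _ => sq_nonneg _)]
  rw [hVZ, hEZ, hvar] at hZ2
  congr 1
  linarith

/-! ### Smoothed densities and the bias-variance decomposition -/

/-- The mean `K_h * f` of the kernel density estimator. -/
noncomputable def smoothed (f K : ℝ → ℝ) (h : ℝ) (x : ℝ) : ℝ := ∫ y, f y * rescale K h (x - y)

/-- The second moment `K_h² * f` of one summand of the kernel density estimator. -/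
noncomputable def smoothedSq (f K : ℝ → ℝ) (h : ℝ) (x : ℝ) : ℝ :=
  ∫ y, f y * rescale K h (x - y) ^ 2

theorem rescale_congr_ae {K K' : ℝ → ℝ} (hKK : K =ᵐ[volume] K') {h : ℝ} (hh : h ≠ 0) :
    rescale K h =ᵐ[volume] rescale K' h := by
  have hq : Measure.QuasiMeasurePreserving (fun x : ℝ => x / h) volume volume := by
    simpa [div_eq_inv_mul] using!
      (Measure.quasiMeasurePreserving_smul volume (inv_ne_zero hh))
  filter_upwards [hq.ae_eq hKK] with x hx
  simp only [Function.comp] at hx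
  simp only [rescale, hx]

theorem integrable_rescale {K : ℝ → ℝ} (hK : Integrable K) {h : ℝ} (hh : h ≠ 0) :
    Integrable (rescale K h) :=
  (hK.comp_div hh).div_const h

theorem integral_rescale_sq (K : ℝ → ℝ) {h : ℝ} (hh : 0 < h) :
    ∫ x, rescale K h x ^ 2 = (∫ x, K x ^ 2) / h := by
  simp only [rescale, div_pow]
  rw [integral_div, Measure.integral_comp_div (fun x => K x ^ 2), abs_of_pos hh, smul_eq_mul]
  field_simp

theorem integrable_sq_of_bounded {K : ℝ → ℝ} (hK : Integrable K) {C : ℝ} (hC : ∀ x, |K x| ≤ C) :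
    Integrable (fun x => K x ^ 2) := by
  refine (hK.norm.const_mul C).mono' (hK.1.pow 2) (ae_of_all _ fun x => ?_)
  rw [Real.norm_eq_abs, abs_pow, sq, Real.norm_eq_abs]
  exact mul_le_mul_of_nonneg_right (hC x) (abs_nonneg _)

theorem integrable_rescale_sq {K : ℝ → ℝ} (hK : Integrable fun x => K x ^ 2) {h : ℝ} (hh : h ≠ 0) :
    Integrable (fun x => rescale K h x ^ 2) := by
  simp only [rescale, div_pow]
  exact (hK.comp_div hh).div_const _

theorem integrable_smoothed {f K : ℝ → ℝ} (hf : Integrable f) (hK : Integrable K) {h : ℝ}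
    (hh : h ≠ 0) : Integrable (smoothed f K h) := by
  simpa [convolution, smoothed] using! hf.integrable_convolution (ContinuousLinearMap.mul ℝ ℝ)
    (integrable_rescale hK hh)

theorem integrable_smoothedSq {f K : ℝ → ℝ} (hf : Integrable f) (hK : Integrable fun x => K x ^ 2)
    {h : ℝ} (hh : h ≠ 0) : Integrable (smoothedSq f K h) := by
  simpa using! hf.integrable_convolution (ContinuousLinearMap.mul ℝ ℝ) (integrable_rescale_sq hK hh)

theorem integral_smoothedSq {f K : ℝ → ℝ} (hf : IsDensity f) (hK : Integrable fun x => K x ^ 2)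
    {h : ℝ} (hh : 0 < h) : ∫ x, smoothedSq f K h x = (∫ x, K x ^ 2) / h := by
  have := integral_convolution (ContinuousLinearMap.mul ℝ ℝ) hf.integrable
    (integrable_rescale_sq hK hh.ne')
  simp only [ContinuousLinearMap.mul_apply', hf.integral_eq_one, one_mul,
    integral_rescale_sq K hh] at this
  exact this

theorem memLp_law_rescale {f K : ℝ → ℝ} (hf : IsDensity f) (hK : AEStronglyMeasurable K) {C : ℝ}
    (hC : ∀ x, |K x| ≤ C) {h : ℝ} (hh : 0 < h) (x : ℝ) :
    MemLp (fun y => rescale K h (x - y)) 2 (law f) := by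
  have := hf.isProbabilityMeasure
  have hm : AEStronglyMeasurable (rescale K h) := by
    have := rescale_congr_ae hK.ae_eq_mk hh.ne'
    refine AEStronglyMeasurable.congr ?_ this.symm
    exact ((hK.stronglyMeasurable_mk.comp_measurable (measurable_id.div_const h)).measurable.div_const
      h).aestronglyMeasurable
  refine MemLp.of_bound ((hm.comp_quasiMeasurePreserving
    (Measure.measurePreserving_sub_left volume x).quasiMeasurePreserving).mono_ac (law_absolutelyContinuous f))
    (C / h) (ae_of_all _ fun y => ?_)
  rw [rescale, Real.norm_eq_abs, abs_div, abs_of_pos hh]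
  gcongr
  exact hC _

/-- The difference of the two sides is the variance of `rescale K h (x - Y)` for `Y` distributed
according to `law f`. -/
theorem smoothed_sq_le {f K : ℝ → ℝ} (hf : IsDensity f) (hK : AEStronglyMeasurable K) {C : ℝ}
    (hC : ∀ x, |K x| ≤ C) {h : ℝ} (hh : 0 < h) (x : ℝ) :
    smoothed f K h x ^ 2 ≤ smoothedSq f K h x := by
  have := hf.isProbabilityMeasure
  have h1 := ProbabilityTheory.variance_eq_sub (memLp_law_rescale hf hK hC hh x)
  have h2 := ProbabilityTheory.variance_nonneg (fun y => rescale K h (x - y)) (law f)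
  rw [h1] at h2
  simp only [Pi.pow_apply, hf.integral_law] at h2
  rw [smoothed, smoothedSq]
  linarith

theorem estimator_congr_ae {K K' : ℝ → ℝ} (hKK : K =ᵐ[volume] K') {h : ℝ} (hh : h ≠ 0) {n : ℕ}
    (X : Fin n → ℝ) : estimator n K h X =ᵐ[volume] estimator n K' h X := by
  have : ∀ i, ∀ᵐ x, rescale K h (x - X i) = rescale K' h (x - X i) := fun i =>
    (measurePreserving_sub_right volume (X i)).quasiMeasurePreserving.ae (rescale_congr_ae hKK hh)
  filter_upwards [ae_all_iff.2 this] with x hx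
  simp only [estimator, hx]

theorem mise_congr_ae {f f' K K' : ℝ → ℝ} (hff : f =ᵐ[volume] f') (hKK : K =ᵐ[volume] K') {h : ℝ}
    (hh : h ≠ 0) (n : ℕ) : mise n f K h = mise n f' K' h := by
  have hl : law f = law f' := withDensity_congr_ae (hff.mono fun x hx => by simp only [hx])
  rw [mise, mise, hl]
  refine lintegral_congr fun X => lintegral_congr_ae ?_
  filter_upwards [hff, estimator_congr_ae hKK hh X] with x h1 h2
  rw [h1, h2]

theorem lintegral_estimator_sub_sq {f K : ℝ → ℝ} (hf : IsDensity f) (hK : AEStronglyMeasurable K)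
    {C : ℝ} (hC : ∀ x, |K x| ≤ C) {h : ℝ} (hh : 0 < h) {n : ℕ} (hn : 0 < n) (x : ℝ) :
    ∫⁻ X : Fin n → ℝ, ENNReal.ofReal ((estimator n K h X x - f x) ^ 2)
      ∂(Measure.pi fun _ : Fin n => law f) =
    ENNReal.ofReal ((smoothed f K h x - f x) ^ 2 +
      1 / (n : ℝ) * (smoothedSq f K h x - smoothed f K h x ^ 2)) := by
  have := hf.isProbabilityMeasure
  have h1 := lintegral_sampleMean_sub_sq (memLp_law_rescale hf hK hC hh x) hn (f x)
  simp only [hf.integral_law] at h1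
  exact h1

/-- Tonelli reduces the claim to the pointwise mean squared error. The swap needs joint
measurability in `(X, x)`, so `f` and `K` are first replaced by measurable modifications; absolute
continuity of `law f` lets the originals return afterwards for almost every `x`. -/
theorem mise_eq_lintegral {f K : ℝ → ℝ} (hf : IsDensity f) (hK : AEStronglyMeasurable K)
    {C : ℝ} (hC : ∀ x, |K x| ≤ C) {h : ℝ} (hh : 0 < h) {n : ℕ} (hn : 0 < n) :
    mise n f K h = ∫⁻ x, ENNReal.ofReal ((smoothed f K h x - f x) ^ 2 +
      1 / (n : ℝ) * (smoothedSq f K h x - smoothed f K h x ^ 2)) := by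
  have := hf.isProbabilityMeasure
  have hfm := hf.integrable.1
  rw [mise_congr_ae hfm.ae_eq_mk hK.ae_eq_mk hh.ne' n]
  have hl : law (hfm.mk f) = law f :=
    withDensity_congr_ae (hfm.ae_eq_mk.symm.mono fun x hx => by simp only [hx])
  rw [mise, hl, lintegral_lintegral_swap]
  · have hswap : ∀ x, f x = hfm.mk f x →
        ∫⁻ X : Fin n → ℝ, ENNReal.ofReal ((estimator n (hK.mk K) h X x - hfm.mk f x) ^ 2)
          ∂(Measure.pi fun _ : Fin n => law f) =
        ∫⁻ X : Fin n → ℝ, ENNReal.ofReal ((estimator n K h X x - f x) ^ 2)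
          ∂(Measure.pi fun _ : Fin n => law f) := by
      intro x hx
      have hi : ∀ i : Fin n, ∀ᵐ X ∂(Measure.pi fun _ : Fin n => law f),
          rescale K h (x - X i) = rescale (hK.mk K) h (x - X i) := fun i =>
        (Measure.quasiMeasurePreserving_eval (fun _ : Fin n => law f) i).ae
          ((law_absolutelyContinuous f).ae_le
            ((Measure.measurePreserving_sub_left volume x).quasiMeasurePreserving.ae
              (rescale_congr_ae hK.ae_eq_mk hh.ne')))
      refine lintegral_congr_ae ?_
      filter_upwards [ae_all_iff.2 hi] with X hX
      simp only [estimator, hX, hx]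
    refine lintegral_congr_ae ?_
    filter_upwards [hfm.ae_eq_mk] with x hx
    rw [hswap x hx, lintegral_estimator_sub_sq hf hK hC hh hn]
  · have h1 := hK.stronglyMeasurable_mk.measurable
    have h2 := hfm.stronglyMeasurable_mk.measurable
    refine Measurable.aemeasurable ?_
    unfold estimator rescale Function.uncurry
    fun_prop

theorem memLp_smoothed {f K : ℝ → ℝ} (hf : IsDensity f) (hK : Integrable K) {C : ℝ}
    (hC : ∀ x, |K x| ≤ C) {h : ℝ} (hh : 0 < h) : MemLp (smoothed f K h) 2 volume := by
  have hi := integrable_smoothed hf.integrable hK hh.ne'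
  refine (memLp_two_iff_integrable_sq hi.1).2
    ((integrable_smoothedSq hf.integrable (integrable_sq_of_bounded hK hC) hh.ne').mono'
      (hi.1.pow 2) (ae_of_all _ fun x => ?_))
  rw [Real.norm_eq_abs, abs_of_nonneg (sq_nonneg _)]
  exact smoothed_sq_le hf hK.1 hC hh x

theorem integral_smoothed_sq_le {f K : ℝ → ℝ} (hf : IsDensity f) (hK : Integrable K) {C : ℝ}
    (hC : ∀ x, |K x| ≤ C) {h : ℝ} (hh : 0 < h) :
    ∫ x, smoothed f K h x ^ 2 ≤ (∫ x, K x ^ 2) / h := by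
  have hK2 := integrable_sq_of_bounded hK hC
  rw [← integral_smoothedSq hf hK2 hh]
  exact integral_mono (memLp_smoothed hf hK hC hh).integrable_sq
    (integrable_smoothedSq hf.integrable hK2 hh.ne') fun x => smoothed_sq_le hf hK.1 hC hh x

/-- The mean integrated squared error as integrated squared bias plus integrated variance. -/
theorem mise_eq_bias_add_variance {f K : ℝ → ℝ} (hf : IsDensity f) (hf2 : MemLp f 2 volume)
    (hK : Integrable K) {C : ℝ} (hC : ∀ x, |K x| ≤ C) {h : ℝ} (hh : 0 < h) {n : ℕ} (hn : 0 < n) :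
    mise n f K h = ENNReal.ofReal ((∫ x, (smoothed f K h x - f x) ^ 2) +
      1 / (n : ℝ) * ((∫ x, K x ^ 2) / h - ∫ x, smoothed f K h x ^ 2)) := by
  have hK2 := integrable_sq_of_bounded hK hC
  have h1 := memLp_smoothed hf hK hC hh
  have h2 := integrable_smoothedSq hf.integrable hK2 hh.ne'
  have h3 : Integrable fun x => (smoothed f K h x - f x) ^ 2 := (h1.sub hf2).integrable_sq
  have h4 : Integrable fun x => 1 / (n : ℝ) * (smoothedSq f K h x - smoothed f K h x ^ 2) :=
    (h2.sub h1.integrable_sq).const_mul _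
  rw [mise_eq_lintegral hf hK.1 hC hh hn]
  rw [← ofReal_integral_eq_lintegral_ofReal]
  · rw [integral_add h3 h4, integral_const_mul, integral_sub h2 h1.integrable_sq,
      integral_smoothedSq hf hK2 hh]
  · exact h3.add h4
  · refine ae_of_all _ fun x => ?_
    have := smoothed_sq_le hf hK.1 hC hh x
    exact add_nonneg (sq_nonneg _) (mul_nonneg (by positivity) (by linarith))

/-! ### The risk on the Fourier side -/

/-- Integrated squared bias, on the Fourier side. -/
noncomputable def biasSq (f K : ℝ → ℝ) (h : ℝ) : ℝ :=
  ∫ ξ, ‖realFourier f ξ‖ ^ 2 * ‖1 - realFourier K (h * ξ)‖ ^ 2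

/-- Squared `L²` norm of `K_h * f`, on the Fourier side. -/
noncomputable def smoothSq (f K : ℝ → ℝ) (h : ℝ) : ℝ :=
  ∫ ξ, ‖realFourier f ξ‖ ^ 2 * ‖realFourier K (h * ξ)‖ ^ 2

/-- `n` times the integrated variance of the kernel density estimator. -/
noncomputable def spread (f K : ℝ → ℝ) (h : ℝ) : ℝ := (∫ x, K x ^ 2) / h - smoothSq f K h

/-- The mean integrated squared error as a real number. -/
noncomputable def risk (n : ℕ) (f K : ℝ → ℝ) (h : ℝ) : ℝ :=
  biasSq f K h + 1 / (n : ℝ) * spread f K h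

theorem realFourier_smoothed {f K : ℝ → ℝ} (hf : Integrable f) (hK : Integrable K) {h : ℝ}
    (hh : 0 < h) (ξ : ℝ) :
    realFourier (smoothed f K h) ξ = realFourier f ξ * realFourier K (h * ξ) := by
  rw [← realFourier_rescale K hh, ← realFourier_convolution hf (integrable_rescale hK hh.ne')]
  rfl

theorem smoothSq_eq {f K : ℝ → ℝ} (hf : IsDensity f) (hK : Integrable K) {C : ℝ}
    (hC : ∀ x, |K x| ≤ C) {h : ℝ} (hh : 0 < h) :
    smoothSq f K h = ∫ x, smoothed f K h x ^ 2 := by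
  rw [← (plancherel (integrable_smoothed hf.integrable hK hh.ne') (memLp_smoothed hf hK hC hh)).2]
  simp only [realFourier_smoothed hf.integrable hK hh, norm_mul, mul_pow, smoothSq]

theorem biasSq_eq {f K : ℝ → ℝ} (hf : IsDensity f) (hf2 : MemLp f 2 volume) (hK : Integrable K)
    {C : ℝ} (hC : ∀ x, |K x| ≤ C) {h : ℝ} (hh : 0 < h) :
    biasSq f K h = ∫ x, (smoothed f K h x - f x) ^ 2 := by
  have hi := integrable_smoothed hf.integrable hK hh.ne'
  rw [← (plancherel (u := fun x => smoothed f K h x - f x) (hi.sub hf.integrable)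
    ((memLp_smoothed hf hK hC hh).sub hf2)).2, biasSq]
  congr with ξ
  rw [realFourier_sub hi hf.integrable, realFourier_smoothed hf.integrable hK hh, ← mul_sub_one,
    norm_mul, mul_pow, norm_sub_rev 1]

theorem mise_eq_risk {f K : ℝ → ℝ} (hf : IsDensity f) (hf2 : MemLp f 2 volume)
    (hK : Integrable K) {C : ℝ} (hC : ∀ x, |K x| ≤ C) {h : ℝ} (hh : 0 < h) {n : ℕ} (hn : 0 < n) :
    mise n f K h = ENNReal.ofReal (risk n f K h) := by
  rw [mise_eq_bias_add_variance hf hf2 hK hC hh hn, risk, spread, biasSq_eq hf hf2 hK hC hh,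
    smoothSq_eq hf hK hC hh]

theorem biasSq_nonneg (f K : ℝ → ℝ) (h : ℝ) : 0 ≤ biasSq f K h :=
  integral_nonneg fun _ => by positivity

theorem spread_nonneg {f K : ℝ → ℝ} (hf : IsDensity f) (hK : Integrable K) {C : ℝ}
    (hC : ∀ x, |K x| ≤ C) {h : ℝ} (hh : 0 < h) : 0 ≤ spread f K h := by
  rw [spread, smoothSq_eq hf hK hC hh, sub_nonneg]
  exact integral_smoothed_sq_le hf hK hC hh

/-! ### Continuity and limits of the risk in the bandwidth -/

theorem continuous_integral_mul_comp_mul {P G : ℝ → ℝ} (hP : Integrable P) (hG : Continuous G)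
    {M : ℝ} (hM : ∀ z, |G z| ≤ M) : Continuous fun h : ℝ => ∫ ξ, P ξ * G (h * ξ) := by
  refine continuous_of_dominated (bound := fun ξ => |P ξ| * M) (fun h => ?_) (fun h => ?_)
    (hP.abs.mul_const M) (ae_of_all _ fun ξ => by fun_prop)
  · exact hP.1.mul (hG.comp (continuous_const_mul h)).aestronglyMeasurable
  · refine ae_of_all _ fun ξ => ?_
    rw [Real.norm_eq_abs, abs_mul]
    exact mul_le_mul_of_nonneg_left (hM _) (abs_nonneg _)

/-- For every `ξ ≠ 0` the point `h * ξ` leaves all compact sets as `h` grows, so dominated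
convergence applies off the null set `{0}`. With Riemann-Lebesgue this yields the limits at infinite
bandwidth. -/
theorem tendsto_integral_mul_comp_mul {P G : ℝ → ℝ} (hP : Integrable P) (hG : Continuous G)
    {M : ℝ} (hM : ∀ z, |G z| ≤ M) {c : ℝ} (hc : Tendsto G (cocompact ℝ) (𝓝 c)) :
    Tendsto (fun h : ℝ => ∫ ξ, P ξ * G (h * ξ)) atTop (𝓝 ((∫ ξ, P ξ) * c)) := by
  rw [← integral_mul_const]
  refine tendsto_integral_filter_of_dominated_convergence (fun ξ => |P ξ| * M)
    (Eventually.of_forall fun h => ?_) (Eventually.of_forall fun h => ?_) (hP.abs.mul_const M) ?_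
  · exact hP.1.mul (hG.comp (continuous_const_mul h)).aestronglyMeasurable
  · refine ae_of_all _ fun ξ => ?_
    rw [Real.norm_eq_abs, abs_mul]
    exact mul_le_mul_of_nonneg_left (hM _) (abs_nonneg _)
  · filter_upwards [Measure.ae_ne volume (0 : ℝ)] with ξ hξ
    refine (hc.comp ?_).const_mul (P ξ)
    rcases hξ.lt_or_gt with hneg | hpos
    · exact (tendsto_id.atTop_mul_const_of_neg hneg).mono_right atBot_le_cocompact
    · exact (tendsto_id.atTop_mul_const hpos).mono_right atTop_le_cocompact

variable {f K : ℝ → ℝ}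

theorem abs_norm_one_sub_realFourier_sq_le (K : ℝ → ℝ) (z : ℝ) :
    |‖1 - realFourier K z‖ ^ 2| ≤ (1 + ∫ x, |K x|) ^ 2 := by
  rw [abs_of_nonneg (by positivity)]
  gcongr
  exact (norm_sub_le _ _).trans (by rw [norm_one]; gcongr; exact norm_realFourier_le K z)

theorem abs_norm_realFourier_sq_le (K : ℝ → ℝ) (z : ℝ) :
    |‖realFourier K z‖ ^ 2| ≤ (∫ x, |K x|) ^ 2 := by
  rw [abs_of_nonneg (by positivity)]
  gcongr
  exact norm_realFourier_le K z

theorem continuous_biasSq (hf : Integrable f) (hf2 : MemLp f 2 volume) (hK : Integrable K) :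
    Continuous (biasSq f K) := by
  have := continuous_realFourier hK
  exact continuous_integral_mul_comp_mul (plancherel hf hf2).1
    (G := fun z => ‖1 - realFourier K z‖ ^ 2) (by fun_prop) (abs_norm_one_sub_realFourier_sq_le K)

theorem continuous_smoothSq (hf : Integrable f) (hf2 : MemLp f 2 volume) (hK : Integrable K) :
    Continuous (smoothSq f K) := by
  have := continuous_realFourier hK
  exact continuous_integral_mul_comp_mul (plancherel hf hf2).1
    (G := fun z => ‖realFourier K z‖ ^ 2) (by fun_prop) (abs_norm_realFourier_sq_le K)

theorem tendsto_biasSq_atTop (hf : Integrable f) (hf2 : MemLp f 2 volume) (hK : Integrable K) :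
    Tendsto (biasSq f K) atTop (𝓝 (∫ x, f x ^ 2)) := by
  have hc := continuous_realFourier hK
  have := tendsto_integral_mul_comp_mul (plancherel hf hf2).1
    (G := fun z => ‖1 - realFourier K z‖ ^ 2) (by fun_prop) (abs_norm_one_sub_realFourier_sq_le K)
    (c := 1) (by simpa using ((tendsto_realFourier_cocompact K).const_sub 1).norm.pow 2)
  rwa [mul_one, (plancherel hf hf2).2] at this

theorem tendsto_smoothSq_atTop (hf : Integrable f) (hf2 : MemLp f 2 volume) (hK : Integrable K) :
    Tendsto (smoothSq f K) atTop (𝓝 0) := by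
  have hc := continuous_realFourier hK
  have := tendsto_integral_mul_comp_mul (plancherel hf hf2).1
    (G := fun z => ‖realFourier K z‖ ^ 2) (by fun_prop) (abs_norm_realFourier_sq_le K)
    (c := 0) (by simpa using (tendsto_realFourier_cocompact K).norm.pow 2)
  rwa [mul_zero] at this

theorem smoothSq_le (hf : Integrable f) (hf2 : MemLp f 2 volume) (h : ℝ) :
    smoothSq f K h ≤ (∫ x, f x ^ 2) * (∫ x, |K x|) ^ 2 := by
  rw [← (plancherel hf hf2).2, ← integral_mul_const]
  refine integral_mono_of_nonneg (ae_of_all _ fun ξ => by positivity)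
    ((plancherel hf hf2).1.mul_const _) (ae_of_all _ fun ξ => ?_)
  exact mul_le_mul_of_nonneg_left ((le_abs_self _).trans (abs_norm_realFourier_sq_le K _))
    (by positivity)

theorem integral_sq_pos (h1 : ∫ x, K x = 1) (hK2 : Integrable fun x => K x ^ 2) :
    0 < ∫ x, K x ^ 2 := by
  refine lt_of_le_of_ne (integral_nonneg fun x => sq_nonneg _) fun h => ?_
  have h0 := (integral_eq_zero_iff_of_nonneg (fun x => sq_nonneg (K x)) hK2).1 h.symm
  have : ∫ x, K x = 0 := by
    rw [integral_congr_ae (g := fun _ => (0 : ℝ)) (h0.mono fun x hx => by simpa using hx)]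
    simp
  linarith

/-- The term `(∫ K²) / h` blows up, while `smoothSq` is bounded uniformly in `h`. -/
theorem tendsto_spread_zero (hf : Integrable f) (hf2 : MemLp f 2 volume) (hK : IsKernel K) :
    Tendsto (spread f K) (𝓝[>] 0) atTop := by
  obtain ⟨C, hC⟩ := hK.bounded
  have hR := integral_sq_pos hK.integral_eq_one
    (integrable_sq_of_bounded hK.integrable hC)
  refine tendsto_atTop_mono (f := fun h => (∫ x, K x ^ 2) * h⁻¹ -
    (∫ x, f x ^ 2) * (∫ x, |K x|) ^ 2) (fun h => ?_) ?_
  · rw [spread, div_eq_mul_inv]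
    linarith [smoothSq_le (K := K) hf hf2 h]
  · exact tendsto_atTop_add_const_right _ _ (tendsto_inv_nhdsGT_zero.const_mul_atTop hR)

theorem continuousOn_risk (hf : Integrable f) (hf2 : MemLp f 2 volume) (hK : Integrable K) (n : ℕ) :
    ContinuousOn (risk n f K) (Set.Ioi 0) := by
  have h1 := continuous_biasSq hf hf2 hK
  have h2 := continuous_smoothSq hf hf2 hK
  refine h1.continuousOn.add (continuousOn_const.mul (ContinuousOn.sub ?_ h2.continuousOn))
  exact continuousOn_const.div continuousOn_id fun x hx => ne_of_gt hx

theorem tendsto_risk_atTop (hf : Integrable f) (hf2 : MemLp f 2 volume) (hK : Integrable K)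
    (n : ℕ) : Tendsto (risk n f K) atTop (𝓝 (∫ x, f x ^ 2)) := by
  have h1 := tendsto_biasSq_atTop hf hf2 hK
  have h2 := tendsto_smoothSq_atTop hf hf2 hK
  have h3 : Tendsto (fun h : ℝ => (∫ x, K x ^ 2) / h) atTop (𝓝 0) :=
    tendsto_const_nhds.div_atTop tendsto_id
  have h4 := h1.add ((h3.sub h2).const_mul (1 / (n : ℝ)))
  rw [sub_zero, mul_zero, add_zero] at h4
  exact h4

theorem tendsto_risk_zero (hf : Integrable f) (hf2 : MemLp f 2 volume) (hK : IsKernel K) {n : ℕ}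
    (hn : 0 < n) : Tendsto (risk n f K) (𝓝[>] 0) atTop :=
  tendsto_atTop_mono (fun h => le_add_of_nonneg_left (biasSq_nonneg f K h))
    ((tendsto_spread_zero hf hf2 hK).const_mul_atTop (by positivity))

/-! ### Existence of an optimal bandwidth -/

/-- `h ⟨K_h * f, f⟩ → K(0)` as the bandwidth grows. -/
theorem tendsto_mul_integral_smoothed_mul (hf : IsDensity f) (hK : IsKernel K) :
    Tendsto (fun h : ℝ => h * ∫ x, smoothed f K h x * f x) atTop (𝓝 (K 0)) := by
  obtain ⟨C, hC⟩ := hK.bounded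
  have hfi := hf.integrable
  have hm : ∀ᶠ h : ℝ in atTop, ∀ x, AEStronglyMeasurable (fun y => K ((x - y) / h)) volume := by
    filter_upwards [eventually_gt_atTop 0] with h hh x
    have h1 := (integrable_rescale hK.integrable hh.ne').1.comp_quasiMeasurePreserving
      (Measure.measurePreserving_sub_left volume x).quasiMeasurePreserving
    refine (h1.mul_const h).congr (ae_of_all _ fun y => ?_)
    simp only [Function.comp, rescale]
    field_simp
  have hb : ∀ h x y, ‖f y * K ((x - y) / h)‖ ≤ |f y| * C := fun h x y => by
    rw [Real.norm_eq_abs, abs_mul]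
    exact mul_le_mul_of_nonneg_left (hC _) (abs_nonneg _)
  have inner : ∀ x, Tendsto (fun h : ℝ => ∫ y, f y * K ((x - y) / h)) atTop (𝓝 (K 0)) := by
    intro x
    have : K 0 = ∫ y, f y * K 0 := by rw [integral_mul_const, hf.integral_eq_one, one_mul]
    rw [this]
    refine tendsto_integral_filter_of_dominated_convergence (fun y => |f y| * C) ?_
      (Eventually.of_forall fun h => ae_of_all _ fun y => hb h x y) (hfi.abs.mul_const C)
      (ae_of_all _ fun y => ?_)
    · filter_upwards [hm] with h hh using hfi.1.mul (hh x)
    · refine (Tendsto.comp hK.continuousAt_zero ?_).const_mul _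
      exact tendsto_const_nhds.div_atTop tendsto_id
  have outer : Tendsto (fun h : ℝ => ∫ x, (∫ y, f y * K ((x - y) / h)) * f x) atTop
      (𝓝 (∫ x, K 0 * f x)) := by
    refine tendsto_integral_filter_of_dominated_convergence (fun x => C * |f x|) ?_
      (Eventually.of_forall fun h => ae_of_all _ fun x => ?_) (hfi.abs.const_mul C)
      (ae_of_all _ fun x => (inner x).mul_const _)
    · filter_upwards [eventually_gt_atTop 0] with h hh
      refine AEStronglyMeasurable.mul ?_ hfi.1
      refine ((integrable_smoothed hfi hK.integrable hh.ne').1.const_mul h).congr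
        (ae_of_all _ fun x => ?_)
      simp only [smoothed]
      rw [← integral_const_mul]
      congr with y
      rw [rescale]
      field_simp
    · rw [Real.norm_eq_abs, abs_mul]
      refine mul_le_mul_of_nonneg_right ?_ (abs_nonneg _)
      refine (norm_integral_le_of_norm_le (hfi.abs.mul_const C) (ae_of_all _ (hb h x))).trans_eq ?_
      rw [integral_mul_const, integral_congr_ae (hf.nonneg.mono fun y hy => abs_of_nonneg hy),
        hf.integral_eq_one, one_mul]
  rw [integral_const_mul, hf.integral_eq_one, mul_one] at outer
  refine outer.congr' ?_
  filter_upwards [eventually_gt_atTop 0] with h hh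
  rw [← integral_const_mul]
  congr with x
  rw [smoothed, ← mul_assoc, ← integral_const_mul]
  congr 2 with y
  rw [rescale]
  field_simp

/-- Since `1 / n ≤ 1`, the risk is at most `biasSq + spread = ∫ f² + (∫ K²) / h - 2 ⟨K_h * f, f⟩`.
Multiplied by `h`, the excess over `∫ f²` tends to `∫ K² - 2 K(0) < 0`; this is the purpose of that
condition on the kernel. -/
theorem exists_risk_lt (hf : IsDensity f) (hf2 : MemLp f 2 volume) (hK : IsKernel K) {n : ℕ}
    (hn : 0 < n) : ∃ h, 0 < h ∧ risk n f K h < ∫ x, f x ^ 2 := by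
  obtain ⟨C, hC⟩ := hK.bounded
  have hlt : (∫ x, K x ^ 2) / 2 < K 0 := by linarith [hK.integral_sq_lt]
  obtain ⟨h, hh, h0⟩ := (((tendsto_mul_integral_smoothed_mul hf hK).eventually_const_lt hlt).and
    (eventually_gt_atTop 0)).exists
  refine ⟨h, h0, ?_⟩
  have hs := memLp_smoothed hf hK.integrable hC h0
  have hB : biasSq f K h = smoothSq f K h - 2 * (∫ x, smoothed f K h x * f x) + ∫ x, f x ^ 2 := by
    rw [biasSq_eq hf hf2 hK.integrable hC h0, smoothSq_eq hf hK.integrable hC h0]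
    have hi : Integrable fun x => smoothed f K h x * f x := hs.integrable_mul hf2
    rw [← integral_const_mul, ← integral_sub hs.integrable_sq (hi.const_mul 2)]
    rw [← integral_add _ hf2.integrable_sq]
    · congr with x
      ring
    · exact hs.integrable_sq.sub (hi.const_mul 2)
  have hS := spread_nonneg hf hK.integrable hC h0
  have hn1 : 1 / (n : ℝ) ≤ 1 := by
    rw [div_le_one (by positivity)]; exact_mod_cast hn
  have h1 : 1 / (n : ℝ) * spread f K h ≤ spread f K h := mul_le_of_le_one_left hS hn1
  have h2 : (∫ x, K x ^ 2) / h < 2 * ∫ x, smoothed f K h x * f x := by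
    rw [div_lt_iff₀ h0]; linarith
  rw [risk]
  rw [spread] at h1 ⊢
  linarith

/-- A value strictly below the limit at infinity, together with the blow-up at zero, confines the
minimisation to a compact interval `[a, b]` on which the risk is continuous. -/
theorem exists_risk_min (hf : IsDensity f) (hf2 : MemLp f 2 volume) (hK : IsKernel K) {n : ℕ}
    (hn : 0 < n) : ∃ h, 0 < h ∧ ∀ h', 0 < h' → risk n f K h ≤ risk n f K h' := by
  obtain ⟨h₀, h₀pos, hlt⟩ := exists_risk_lt hf hf2 hK hn
  have e1 := (tendsto_risk_zero hf.integrable hf2 hK hn).eventually_gt_atTop (risk n f K h₀)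
  have e2 := (tendsto_risk_atTop hf.integrable hf2 hK.integrable n).eventually_const_lt hlt
  obtain ⟨a, ha, ha'⟩ := mem_nhdsGT_iff_exists_Ioo_subset.1 e1
  obtain ⟨b, hb⟩ := eventually_atTop.1 e2
  have ha0 : 0 < a := ha
  have hah : a ≤ h₀ := by
    by_contra! hc
    exact lt_irrefl (risk n f K h₀) (ha' ⟨h₀pos, hc⟩)
  have hhb : h₀ ≤ b := by
    by_contra! hc
    exact lt_irrefl _ (hb h₀ hc.le)
  obtain ⟨h, hh, hmin⟩ := isCompact_Icc.exists_isMinOn (s := Set.Icc a b) ⟨h₀, hah, hhb⟩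
    ((continuousOn_risk hf.integrable hf2 hK.integrable n).mono fun x hx => ha0.trans_le hx.1)
  have hle : risk n f K h ≤ risk n f K h₀ := hmin ⟨hah, hhb⟩
  refine ⟨h, ha0.trans_le hh.1, fun h' hh' => ?_⟩
  rcases lt_or_ge h' a with h1 | h1
  · exact hle.trans (le_of_lt (ha' ⟨hh', h1⟩))
  · rcases le_or_gt h' b with h2 | h2
    · exact hmin ⟨h1, h2⟩
    · exact hle.trans (hb h' h2.le).le

theorem exists_mise_eq_minMise (hf : IsDensity f) (hf2 : MemLp f 2 volume) (hK : IsKernel K) {n : ℕ}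
    (hn : 0 < n) : ∃ h, 0 < h ∧ mise n f K h = minMise n f K := by
  obtain ⟨C, hC⟩ := hK.bounded
  obtain ⟨h, hh, hmin⟩ := exists_risk_min hf hf2 hK hn
  refine ⟨h, hh, le_antisymm (le_iInf fun h' => ?_) (iInf_le (fun h' : Set.Ioi (0 : ℝ) =>
    mise n f K h') ⟨h, hh⟩)⟩
  rw [mise_eq_risk hf hf2 hK.integrable hC hh hn, mise_eq_risk hf hf2 hK.integrable hC h'.2 hn]
  exact ENNReal.ofReal_le_ofReal (hmin _ h'.2)

/-! ### Strict positivity of the risk -/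

theorem IsDensity.norm_realFourier_le_one (hf : IsDensity f) (ξ : ℝ) : ‖realFourier f ξ‖ ≤ 1 := by
  refine (norm_realFourier_le f ξ).trans_eq ?_
  rw [integral_congr_ae (hf.nonneg.mono fun y hy => abs_of_nonneg hy), hf.integral_eq_one]

/-- Plancherel applied to `K_h` turns `(∫ K²) / h` into `∫ |K̂(hξ)|²`. The resulting integrand is
nonnegative, which makes the case of zero spread tractable. -/
theorem spread_eq_integral (hf : IsDensity f) (hf2 : MemLp f 2 volume) (hK : Integrable K) {C : ℝ}
    (hC : ∀ x, |K x| ≤ C) {h : ℝ} (hh : 0 < h) :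
    (Integrable fun ξ => ‖realFourier K (h * ξ)‖ ^ 2 * (1 - ‖realFourier f ξ‖ ^ 2)) ∧
      spread f K h = ∫ ξ, ‖realFourier K (h * ξ)‖ ^ 2 * (1 - ‖realFourier f ξ‖ ^ 2) := by
  have hr := integrable_rescale hK hh.ne'
  have hr2 : MemLp (rescale K h) 2 volume := (memLp_two_iff_integrable_sq hr.1).2
    (integrable_rescale_sq (integrable_sq_of_bounded hK hC) hh.ne')
  obtain ⟨h1, h2⟩ := plancherel hr hr2
  simp only [realFourier_rescale K hh, integral_rescale_sq K hh] at h1 h2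
  have h3 : Integrable fun ξ => ‖realFourier f ξ‖ ^ 2 * ‖realFourier K (h * ξ)‖ ^ 2 := by
    refine (plancherel hf.integrable hf2).1.mul_bdd (c := (∫ x, |K x|) ^ 2) ?_ (ae_of_all _ fun ξ => ?_)
    · exact h1.1
    · exact abs_norm_realFourier_sq_le K (h * ξ)
  have he : (fun ξ => ‖realFourier K (h * ξ)‖ ^ 2 * (1 - ‖realFourier f ξ‖ ^ 2)) = fun ξ =>
      ‖realFourier K (h * ξ)‖ ^ 2 - ‖realFourier f ξ‖ ^ 2 * ‖realFourier K (h * ξ)‖ ^ 2 := by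
    ext ξ; ring
  rw [he]
  exact ⟨h1.sub h3, by rw [integral_sub h1 h3, h2]; rfl⟩

theorem integrable_biasSq (hf : Integrable f) (hf2 : MemLp f 2 volume) (hK : Integrable K) (h : ℝ) :
    Integrable fun ξ => ‖realFourier f ξ‖ ^ 2 * ‖1 - realFourier K (h * ξ)‖ ^ 2 := by
  have hc := continuous_realFourier hK
  refine (plancherel hf hf2).1.mul_bdd (c := (1 + ∫ x, |K x|) ^ 2) ?_ (ae_of_all _ fun ξ => ?_)
  · exact Continuous.aestronglyMeasurable (by fun_prop)
  · exact abs_norm_one_sub_realFourier_sq_le K (h * ξ)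

theorem ae_eq_zero_or_eq_one_of_biasSq_eq_zero (hf : Integrable f) (hf2 : MemLp f 2 volume)
    (hK : Integrable K) {h : ℝ} (h0 : biasSq f K h = 0) :
    ∀ᵐ ξ, realFourier f ξ = 0 ∨ realFourier K (h * ξ) = 1 := by
  have := (integral_eq_zero_iff_of_nonneg (fun ξ => by positivity)
    (integrable_biasSq hf hf2 hK h)).1 h0
  filter_upwards [this] with ξ hξ
  rcases mul_eq_zero.1 hξ with h1 | h1
  · left; simpa using h1
  · right
    have := norm_eq_zero.1 (pow_eq_zero_iff two_ne_zero |>.1 h1)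
    exact (sub_eq_zero.1 this).symm

/-- The error of a kernel density estimator never vanishes. -/
theorem risk_pos (hf : IsDensity f) (hf2 : MemLp f 2 volume) (hK : Integrable K) {C : ℝ}
    (hC : ∀ x, |K x| ≤ C) {h : ℝ} (hh : 0 < h) {n : ℕ} (hn : 0 < n) : 0 < risk n f K h := by
  have hb := biasSq_nonneg f K h
  have hs := spread_nonneg hf hK hC hh
  have hn' : 0 < 1 / (n : ℝ) := by positivity
  refine lt_of_le_of_ne (add_nonneg hb (mul_nonneg hn'.le hs)) fun h0 => ?_
  rw [risk] at h0
  have hms := mul_nonneg hn'.le hs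
  have hb0 : biasSq f K h = 0 := by linarith
  have hs0 : spread f K h = 0 := by
    have : 1 / (n : ℝ) * spread f K h = 0 := by linarith
    exact (mul_eq_zero.1 this).resolve_left hn'.ne'
  obtain ⟨hi, he⟩ := spread_eq_integral hf hf2 hK hC hh
  have h1 := (integral_eq_zero_iff_of_nonneg (fun ξ => ?_) hi).1 (he.symm.trans hs0)
  swap
  · have := hf.norm_realFourier_le_one ξ
    have : ‖realFourier f ξ‖ ^ 2 ≤ 1 := pow_le_one₀ (norm_nonneg _) this
    exact mul_nonneg (by positivity) (by linarith)
  have hc := continuous_realFourier hf.integrable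
  -- Where `f̂ ≠ 0`, zero bias forces `K̂(hξ) = 1`, and then zero spread forces `|f̂| = 1`. By
  -- continuity `|f̂|` avoids `(0, 1)` everywhere, yet it must pass from `1` at the origin to `0` at
  -- infinity.
  have hae : ∀ᵐ ξ, ‖realFourier f ξ‖ ∉ Set.Ioo (0 : ℝ) 1 := by
    filter_upwards [h1, ae_eq_zero_or_eq_one_of_biasSq_eq_zero hf.integrable hf2 hK hb0] with ξ h2 h3
    rintro ⟨h4, h5⟩
    have h6 := h3.resolve_left (norm_pos_iff.1 h4)
    simp only [h6, norm_one, one_pow, one_mul, Pi.zero_apply] at h2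
    nlinarith
  have hopen : IsOpen {ξ | ‖realFourier f ξ‖ ∈ Set.Ioo (0 : ℝ) 1} := isOpen_Ioo.preimage hc.norm
  have hempty : {ξ | ‖realFourier f ξ‖ ∈ Set.Ioo (0 : ℝ) 1} = ∅ := by
    have : volume {ξ | ‖realFourier f ξ‖ ∈ Set.Ioo (0 : ℝ) 1} = 0 := by
      rw [ae_iff] at hae; simpa only [not_not] using hae
    exact hopen.measure_eq_zero_iff volume |>.1 this
  have hlim : Tendsto (fun ξ => ‖realFourier f ξ‖) atTop (𝓝 0) := by
    simpa using ((tendsto_realFourier_cocompact f).mono_left atTop_le_cocompact).norm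
  obtain ⟨b, hb1, hb2⟩ := ((hlim.eventually_lt_const (by norm_num : (0 : ℝ) < 1 / 2)).and
    (eventually_ge_atTop 0)).exists
  have hzero : ‖realFourier f 0‖ = 1 := by rw [realFourier_zero, hf.integral_eq_one]; simp
  obtain ⟨ξ, -, hξ⟩ := intermediate_value_Icc' hb2 hc.norm.continuousOn
    (show (1 / 2 : ℝ) ∈ _ from ⟨hb1.le, by rw [hzero]; norm_num⟩)
  have : ξ ∈ {ξ | ‖realFourier f ξ‖ ∈ Set.Ioo (0 : ℝ) 1} := by
    simp only [Set.mem_ofPred_eq] at hξ ⊢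
    rw [hξ]; norm_num
  rw [hempty] at this
  exact this

/-! ### Exact order and unbiased bandwidths -/

theorem natCast_mul_mise (hf : IsDensity f) (hf2 : MemLp f 2 volume) (hK : Integrable K) {C : ℝ}
    (hC : ∀ x, |K x| ≤ C) {h : ℝ} (hh : 0 < h) {n : ℕ} (hn : 0 < n) :
    (n : ℝ≥0∞) * mise n f K h = ENNReal.ofReal (n * biasSq f K h + spread f K h) := by
  rw [mise_eq_risk hf hf2 hK hC hh hn, ← ENNReal.ofReal_natCast,
    ← ENNReal.ofReal_mul (Nat.cast_nonneg _), risk]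
  congr 1
  field_simp

/-- For fixed `h`, `n * biasSq + spread` is nondecreasing in `n`; the bandwidth optimal for the
larger sample serves as competitor for the smaller one. -/
theorem monotone_natCast_mul_minMise (hf : IsDensity f) (hf2 : MemLp f 2 volume)
    (hK : IsKernel K) : Monotone fun n : ℕ => (n : ℝ≥0∞) * minMise n f K := by
  obtain ⟨C, hC⟩ := hK.bounded
  intro n m hnm
  rcases Nat.eq_zero_or_pos n with rfl | hn
  · simp
  obtain ⟨h, hh, hm⟩ := exists_mise_eq_minMise hf hf2 hK (hn.trans_le hnm)
  have hle : minMise n f K ≤ mise n f K h :=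
    iInf_le (fun h' : Set.Ioi (0 : ℝ) => mise n f K h') ⟨h, hh⟩
  simp only
  rw [← hm, natCast_mul_mise hf hf2 hK.integrable hC hh (hn.trans_le hnm)]
  refine (mul_le_mul_right hle _).trans ?_
  rw [natCast_mul_mise hf hf2 hK.integrable hC hh hn]
  refine ENNReal.ofReal_le_ofReal ?_
  have := biasSq_nonneg f K h
  gcongr

/-- If some bandwidth is unbiased for the density `f`, then the optimal error is of exact order
`n⁻¹`. -/
theorem isExactOrderInv_of_biasSq_eq_zero (hf : IsDensity f) (hf2 : MemLp f 2 volume)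
    (hK : IsKernel K) {h₀ : ℝ} (hh₀ : 0 < h₀) (h0 : biasSq f K h₀ = 0) :
    IsExactOrderInv fun n : ℕ => minMise n f K := by
  obtain ⟨C, hC⟩ := hK.bounded
  have hmono := monotone_natCast_mul_minMise hf hf2 hK
  refine ⟨⨆ n : ℕ, (n : ℝ≥0∞) * minMise n f K, ?_, ?_, tendsto_atTop_iSup hmono⟩
  · obtain ⟨h, hh, hm⟩ := exists_mise_eq_minMise hf hf2 hK one_pos
    refine lt_of_lt_of_le ?_ (le_iSup (fun n : ℕ => (n : ℝ≥0∞) * minMise n f K) 1)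
    rw [← hm, mise_eq_risk hf hf2 hK.integrable hC hh one_pos, Nat.cast_one, one_mul,
      ENNReal.ofReal_pos]
    exact risk_pos hf hf2 hK.integrable hC hh one_pos
  · refine lt_of_le_of_lt (iSup_le fun n => ?_) (ENNReal.ofReal_lt_top (r := spread f K h₀))
    rcases Nat.eq_zero_or_pos n with rfl | hn
    · simp
    refine (mul_le_mul_right (iInf_le (fun h' : Set.Ioi (0 : ℝ) => mise n f K h') ⟨h₀, hh₀⟩)
      _).trans ?_
    simp only
    rw [natCast_mul_mise hf hf2 hK.integrable hC hh₀ hn, h0, mul_zero, zero_add]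

/-- If no bandwidth is unbiased for the density `f`, then the optimal error is not of order
`n⁻¹`. -/
theorem not_isExactOrderInv_of_biasSq_pos (hf : IsDensity f) (hf2 : MemLp f 2 volume)
    (hK : IsKernel K) (hpos : ∀ h, 0 < h → 0 < biasSq f K h) :
    ¬ IsExactOrderInv fun n : ℕ => minMise n f K := by
  obtain ⟨C, hC⟩ := hK.bounded
  rintro ⟨α, -, hα, hlim⟩
  -- The spread alone excludes bandwidths below `δ` at the level `α + 1`. Beyond `δ` the bias has a
  -- positive lower bound `c`, by compactness and its positive limit `∫ f²`, so `n * c` exceeds that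
  -- level for large `n`.
  obtain ⟨δ, hδ, hδ'⟩ := mem_nhdsGT_iff_exists_Ioo_subset.1
    ((tendsto_spread_zero hf.integrable hf2 hK).eventually_gt_atTop (α.toReal + 1))
  have hδ0 : 0 < δ := hδ
  have hF : 0 < ∫ x, f x ^ 2 := integral_sq_pos hf.integral_eq_one hf2.integrable_sq
  obtain ⟨b, hb⟩ := eventually_atTop.1
    ((tendsto_biasSq_atTop hf.integrable hf2 hK.integrable).eventually_const_lt (half_lt_self hF))
  have hc : ∃ c > 0, ∀ h, δ ≤ h → c ≤ biasSq f K h := by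
    obtain ⟨h, hh, hmin⟩ := isCompact_Icc.exists_isMinOn (s := Set.Icc δ (max δ b))
      ⟨δ, le_rfl, le_max_left _ _⟩
      (continuous_biasSq hf.integrable hf2 hK.integrable).continuousOn
    refine ⟨min (biasSq f K h) ((∫ x, f x ^ 2) / 2),
      lt_min (hpos h (hδ0.trans_le hh.1)) (half_pos hF), fun h' hh' => ?_⟩
    rcases le_total h' (max δ b) with h1 | h1
    · exact (min_le_left _ _).trans (hmin ⟨hh', h1⟩)
    · exact (min_le_right _ _).trans (hb h' ((le_max_right _ _).trans h1)).le
  obtain ⟨c, hc0, hc⟩ := hc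
  have hev : ∀ᶠ n : ℕ in atTop, (n : ℝ≥0∞) * minMise n f K < ENNReal.ofReal (α.toReal + 1) := by
    refine hlim.eventually_lt_const ?_
    rw [ENNReal.lt_ofReal_iff_toReal_lt hα.ne]
    linarith
  obtain ⟨n, hn1, hn0, hn2⟩ := (hev.and ((eventually_gt_atTop 0).and
    ((tendsto_natCast_atTop_atTop.atTop_mul_const hc0).eventually_gt_atTop (α.toReal + 1)))).exists
  obtain ⟨h, hh, hm⟩ := exists_mise_eq_minMise hf hf2 hK hn0
  rw [← hm, natCast_mul_mise hf hf2 hK.integrable hC hh hn0] at hn1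
  have h3 := ENNReal.ofReal_lt_ofReal_iff_of_nonneg (add_nonneg (mul_nonneg (Nat.cast_nonneg n)
    (biasSq_nonneg f K h)) (spread_nonneg hf hK.integrable hC hh)) |>.1 hn1
  have hs := spread_nonneg hf hK.integrable hC hh
  have hδh : δ ≤ h := by
    by_contra! hlt
    have h4 : α.toReal + 1 < spread f K h := hδ' ⟨hh, hlt⟩
    have := mul_nonneg (Nat.cast_nonneg (α := ℝ) n) (biasSq_nonneg f K h)
    linarith
  have := mul_le_mul_of_nonneg_left (hc h hδh) (Nat.cast_nonneg (α := ℝ) n)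
  linarith

/-! ### Exit points and the set where the transform of the kernel equals one -/

theorem exists_realFourier_eq_one (hS : 0 < firstExit K) :
    ∃ ε > 0, ∀ ξ, |ξ| < ε → realFourier K ξ = 1 := by
  have hpi := Real.pi_pos
  -- The sign conventions differ: `t ≥ 0` in `charFn` corresponds to `ξ = -t / (2π) ≤ 0`. Positive
  -- frequencies follow by conjugation, as `K` is real.
  have hneg : ∀ ξ ≤ 0, -ξ < firstExit K / (2 * Real.pi) → realFourier K ξ = 1 := by
    intro ξ hξ hlt
    rw [lt_div_iff₀ (by positivity)] at hlt
    by_contra hne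
    refine absurd (csInf_le ⟨0, fun t ht => ht.1⟩ (show -ξ * (2 * Real.pi) ∈
      {t : ℝ | 0 ≤ t ∧ ‖charFn K t - 1‖ ≠ 0} from ⟨mul_nonneg (by linarith) (by positivity), ?_⟩))
      (not_le.2 hlt)
    rw [charFn_eq_realFourier, norm_ne_zero_iff, sub_ne_zero]
    convert hne using 2
    field_simp
  refine ⟨firstExit K / (2 * Real.pi), by positivity, fun ξ hξ => ?_⟩
  rcases le_total ξ 0 with h | h
  · exact hneg ξ h (by rwa [abs_of_nonpos h] at hξ)
  · rw [← neg_neg ξ, realFourier_neg, hneg (-ξ) (by linarith) (by rwa [neg_neg, ← abs_of_nonneg h]),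
      map_one]

theorem ae_realFourier_ne_one (hT : lastExit K = 0) : ∀ᵐ ξ, ξ < 0 → realFourier K ξ ≠ 1 := by
  have hpi := Real.pi_pos
  -- The real `sInf` of the empty set is `0`, so `lastExit K = 0` is informative only once this set
  -- is known to be nonempty; Riemann-Lebesgue provides an element.
  have hne : {r : ℝ | 0 ≤ r ∧ ∀ᵐ t : ℝ, r ≤ t → ‖charFn K t - 1‖ ≠ 0}.Nonempty := by
    have h1 : Tendsto (fun t : ℝ => realFourier K (-t / (2 * Real.pi))) atTop (𝓝 0) := by
      refine (tendsto_realFourier_cocompact K).comp (Tendsto.mono_right ?_ atBot_le_cocompact)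
      exact tendsto_neg_atTop_atBot.atBot_div_const (by positivity)
    obtain ⟨b, hb⟩ := eventually_atTop.1 (h1.eventually_ne zero_ne_one)
    refine ⟨max 0 b, le_max_left _ _, ae_of_all _ fun t ht => ?_⟩
    rw [charFn_eq_realFourier, norm_ne_zero_iff, sub_ne_zero]
    exact hb t ((le_max_right _ _).trans ht)
  have h2 : ∀ k : ℕ, ∀ᵐ t : ℝ, 1 / ((k : ℝ) + 1) ≤ t → ‖charFn K t - 1‖ ≠ 0 := fun k => by
    obtain ⟨r, ⟨-, hr⟩, hrk⟩ := exists_lt_of_csInf_lt hne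
      (show sInf _ < 1 / ((k : ℝ) + 1) from hT.trans_lt (by positivity))
    exact hr.mono fun t ht hkt => ht (hrk.le.trans hkt)
  have h3 : ∀ᵐ t : ℝ, 0 < t → ‖charFn K t - 1‖ ≠ 0 := by
    filter_upwards [ae_all_iff.2 h2] with t ht h0
    obtain ⟨k, hk⟩ := exists_nat_one_div_lt h0
    exact ht k hk.le
  have hq := (Measure.quasiMeasurePreserving_smul (volume : Measure ℝ)
    (r := -(2 * Real.pi)) (by linarith)).ae h3
  filter_upwards [hq] with ξ hξ h0
  simp only [smul_eq_mul] at hξ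
  have h4 := hξ (by nlinarith)
  rw [charFn_eq_realFourier, norm_ne_zero_iff, sub_ne_zero] at h4
  convert h4 using 2
  field_simp

/-- Zero bias would need `f̂ = 0` or `K̂(hξ) = 1` almost everywhere. Both fail almost everywhere on
a short interval to the left of zero, because `f̂(0) = 1` and `lastExit K = 0`. -/
theorem biasSq_pos (hf : IsDensity f) (hf2 : MemLp f 2 volume) (hK : Integrable K)
    (hT : lastExit K = 0) {h : ℝ} (hh : 0 < h) : 0 < biasSq f K h := by
  refine lt_of_le_of_ne (biasSq_nonneg f K h) fun h0 => ?_
  have h1 := ae_eq_zero_or_eq_one_of_biasSq_eq_zero hf.integrable hf2 hK h0.symm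
  have h2 := (Measure.quasiMeasurePreserving_smul (volume : Measure ℝ) hh.ne').ae
    (ae_realFourier_ne_one hT)
  have hzero : realFourier f 0 ≠ 0 := by rw [realFourier_zero, hf.integral_eq_one]; simp
  obtain ⟨δ, hδ, hball⟩ := Metric.eventually_nhds_iff.1
    ((continuous_realFourier hf.integrable).continuousAt.eventually_ne hzero)
  have hnull : ∀ᵐ ξ : ℝ, ξ ∉ Set.Ioo (-δ) 0 := by
    filter_upwards [h1, h2] with ξ h3 h4 h5
    rcases h3 with h6 | h6
    · refine hball ?_ h6
      rw [Real.dist_eq, sub_zero, abs_of_neg h5.2]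
      linarith [h5.1]
    · exact h4 (by rw [smul_eq_mul]; exact mul_neg_of_pos_of_neg hh h5.2) h6
  have : volume (Set.Ioo (-δ) 0) = 0 := by
    rw [ae_iff] at hnull; simpa only [not_not, Set.ofPred_mem_eq] using hnull
  rw [Real.volume_Ioo, ENNReal.ofReal_eq_zero] at this
  linarith

/-! ### Band-limited densities -/

/-- There are square-integrable densities with Fourier transform supported near zero. -/
theorem exists_density_bandlimited {ε : ℝ} (hε : 0 < ε) :
    ∃ f : ℝ → ℝ, IsDensity f ∧ MemLp f 2 volume ∧ ∀ ξ, ε ≤ |ξ| → realFourier f ξ = 0 := by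
  -- The density is the normalised square of the transform of `β`, whose own transform is `β * β` up
  -- to reflection and normalisation. The outer radius `ε / 2` makes this convolution vanish for `ε
  -- ≤ |ξ|`.
  let β : ContDiffBump (0 : ℝ) := ⟨ε / 4, ε / 2, by positivity, by linarith⟩
  have hcs : HasCompactSupport fun x => (β x : ℂ) :=
    β.hasCompactSupport.comp_left (g := fun x : ℝ => (x : ℂ)) rfl
  let w : 𝓢(ℝ, ℂ) := hcs.toSchwartzMap (Complex.ofRealCLM.contDiff.comp β.contDiff)
  have hw : ∀ x, w x = (β x : ℂ) := fun x => rfl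
  have hwβ : ∀ ξ, 𝓕 (w : ℝ → ℂ) ξ = realFourier β ξ := fun ξ => rfl
  -- Evenness of `β` makes its transform real, so its square is nonnegative and equals the transform
  -- of `β * β`.
  have hreal : ∀ ξ, (((realFourier β ξ).re : ℝ) : ℂ) = realFourier β ξ := fun ξ => by
    rw [← Complex.conj_eq_iff_re, ← realFourier_neg, ← hwβ, ← hwβ, ← Real.fourierInv_eq_fourier_neg,
      Real.fourierInv_eq_fourier_comp_neg]
    refine congrArg (fun v : ℝ → ℂ => 𝓕 v ξ) (funext fun x => ?_)
    rw [hw, hw, β.neg]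
  let u : 𝓢(ℝ, ℂ) := SchwartzMap.convolution (ContinuousLinearMap.mul ℂ ℂ) w w
  have hu : ∀ ξ, (𝓕 u : 𝓢(ℝ, ℂ)) ξ = (((realFourier β ξ).re ^ 2 : ℝ) : ℂ) := fun ξ => by
    rw [SchwartzMap.fourier_convolution_apply,
      Real.fourier_mul_convolution_eq w.integrable w.integrable, hwβ]
    push_cast
    rw [hreal, sq]
  let g : ℝ → ℝ := fun ξ => (realFourier β ξ).re ^ 2
  have hg : ∀ ξ, ((g ξ : ℝ) : ℂ) = (𝓕 u : 𝓢(ℝ, ℂ)) ξ := fun ξ => (hu ξ).symm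
  have hre : g = fun ξ => ((𝓕 u : 𝓢(ℝ, ℂ)) ξ).re := by
    ext ξ; rw [← hg, Complex.ofReal_re]
  have hgi : Integrable g := by rw [hre]; exact (𝓕 u : 𝓢(ℝ, ℂ)).integrable.re
  have hg2 : MemLp g 2 volume := by rw [hre]; exact ((𝓕 u : 𝓢(ℝ, ℂ)).memLp 2).re
  have hgc : Continuous g := by
    rw [hre]; exact Complex.continuous_re.comp (𝓕 u : 𝓢(ℝ, ℂ)).continuous
  have hg0 : g 0 ≠ 0 := by
    have : 0 < ∫ x, β x := β.integral_pos
    simp only [g, realFourier_zero, Complex.ofReal_re]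
    positivity
  have hI : 0 < ∫ x, g x :=
    integral_pos_of_integrable_nonneg_nonzero hgc hgi (fun x => sq_nonneg _) hg0
  have hFg : ∀ ξ, ε ≤ |ξ| → realFourier g ξ = 0 := fun ξ hξ => by
    -- Fourier inversion: `g` is the transform of `u`, and transforming twice reflects.
    have h1 : realFourier g ξ = u (-ξ) := by
      have h2 : (fun x => ((g x : ℝ) : ℂ)) = ((𝓕 u : 𝓢(ℝ, ℂ)) : ℝ → ℂ) := funext hg
      rw [realFourier, h2, ← neg_neg ξ, ← Real.fourierInv_eq_fourier_neg, neg_neg,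
        ← SchwartzMap.fourierInv_coe, FourierTransform.fourierInv_fourier_eq]
    rw [h1, SchwartzMap.convolution_apply, convolution_def]
    refine integral_eq_zero_of_ae (ae_of_all _ fun t => ?_)
    simp only [ContinuousLinearMap.mul_apply', hw, Pi.zero_apply]
    by_cases ht : ε / 2 ≤ |t|
    · rw [β.zero_of_le_dist (by simpa using ht)]; simp
    · have h3 : ε / 2 ≤ |-ξ - t| := by
        have := abs_sub_abs_le_abs_sub (-ξ) t
        rw [abs_neg] at this
        linarith
      rw [β.zero_of_le_dist (x := -ξ - t) (by simpa using h3)]; simp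
  refine ⟨fun x => (∫ x, g x)⁻¹ * g x, ⟨hgi.const_mul _, ae_of_all _ fun x => ?_, ?_⟩,
    hg2.const_mul _, fun ξ hξ => ?_⟩
  · exact mul_nonneg (inv_nonneg.2 hI.le) (sq_nonneg _)
  · rw [integral_const_mul, inv_mul_cancel₀ hI.ne']
  · have h1 := hFg ξ hξ
    rw [realFourier_apply] at h1 ⊢
    have : ∀ x : ℝ, Complex.exp (↑(-2 * Real.pi * x * ξ) * Complex.I) *
        (((∫ x, g x)⁻¹ * g x : ℝ) : ℂ) = (((∫ x, g x)⁻¹ : ℝ) : ℂ) *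
        (Complex.exp (↑(-2 * Real.pi * x * ξ) * Complex.I) * (g x : ℂ)) := fun x => by
      push_cast; ring
    simp only [this]
    rw [integral_const_mul, h1, mul_zero]

end KernelDensity

/-! ### Assembly of the theorem -/

theorem theorem2 (K : ℝ → ℝ) (hK : KernelDensity.IsKernel K) (hK2 : MemLp K 2 volume)
    (hST : KernelDensity.firstExit K = KernelDensity.lastExit K) :
    (∀ f : ℝ → ℝ, KernelDensity.IsDensity f → MemLp f 2 volume → ∀ n : ℕ, 0 < n →
      ∃ h : ℝ, 0 < h ∧ KernelDensity.mise n f K h = KernelDensity.minMise n f K) ∧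
    (0 < KernelDensity.firstExit K ↔
      ∃ f : ℝ → ℝ, KernelDensity.IsDensity f ∧ MemLp f 2 volume ∧
        KernelDensity.IsExactOrderInv (fun n : ℕ => KernelDensity.minMise n f K)) := by
  refine ⟨fun f hf hf2 n hn => KernelDensity.exists_mise_eq_minMise hf hf2 hK hn,
    fun hS => ?_, fun ⟨f, hf, hf2, hord⟩ => ?_⟩
  · obtain ⟨ε, hε, hone⟩ := KernelDensity.exists_realFourier_eq_one hS
    obtain ⟨f, hf, hf2, hband⟩ := KernelDensity.exists_density_bandlimited hε
    -- Bandwidth `1` is unbiased: at each frequency either `K̂ = 1` or `f̂ = 0`.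
    refine ⟨f, hf, hf2,
      KernelDensity.isExactOrderInv_of_biasSq_eq_zero hf hf2 hK one_pos ?_⟩
    refine integral_eq_zero_of_ae (ae_of_all _ fun ξ => ?_)
    simp only [one_mul, Pi.zero_apply]
    rcases lt_or_ge |ξ| ε with h | h
    · rw [hone ξ h]; simp
    · rw [hband ξ h]; simp
  -- If `firstExit K` is not positive it is zero, and the hypothesis `hST` transfers this to
  -- `lastExit K`, so no bandwidth is unbiased.
  · refine lt_of_le_of_ne (Real.sInf_nonneg fun t ht => ht.1) fun h0 => ?_
    exact KernelDensity.not_isExactOrderInv_of_biasSq_pos hf hf2 hK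
      (fun h hh => KernelDensity.biasSq_pos hf hf2 hK.integrable (hST.symm.trans h0.symm) hh) hord
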